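/- Let $\mathcal H$ be a complex Hilbert space, let $\mathcal K$ be a Hilbert space with orthonormal basis $(|i\rangle)_{i\in\Lambda}$, and let $B^i_j$ ($i,j\in\Lambda$) be bounded operators on $\mathcal H$ with $\sum_i B^{i*}_jB^i_j=\mathbf 1$ strongly for every $j$. Let $\rho=\sum_i\rho_i\otimes|i\rangle\langle i|$ be a density operator, where the $\rho_i$ are positive trace class operators on $\mathcal H$ with $\sum_i\operatorname{Tr}(\rho_i)=1$. Put $I_\rho^c=\{i:\rho_i\ne0\}$, let $\mathcal K^\rho$ be the closed span of $\{|i\rangle: i\in I_\rho^c\}$ (so $\mathcal K^\rho=\mathcal K$ if all $\rho_i\neq 0$), and $M^i_j=B^i_j\otimes|i\rangle\langle j|:\mathcal H\otimes\mathcal K^\rho\to\mathcal H\otimes\mathcal K$ for $i\in\Lambda$, $j\in I_\rho^c$. Operators $x\in B(\mathcal H\otimes\mathcal K^\rho)$ are viewed as operators on $\mathcal H\otimes\mathcal K$ by setting them to be zero on the orthogonal complement of $\mathcal H\otimes\mathcal K^\rho$. For $x,y\in B(\mathcal H\otimes\mathcal K^\rho)$ let $$\mathcal E(x\otimes y)=\sum_{i\in\Lambda,\;j\in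 I^c_\rho}M^{i*}_j\,x\,M^i_j\;\frac{\operatorname{Tr}\big((\rho_j\otimes|j\rangle\langle j|)\,y\big)}{\operatorname{Tr}(\rho_j)}$$ (strong sum). A state $\varphi$ on the infinite C*-tensor product $\mathcal A^\rho=\bigotimes_{k\in\mathbb Z_+}B(\mathcal H\otimes\mathcal K^\rho)$ is called a quantum Markov chain (QMC) for the pair $(\rho,\mathcal E)$ if, for all $n\ge1$ and all $x_1,\dots,x_n\in B(\mathcal H\otimes\mathcal K^\rho)$, $$\varphi(x_1\otimes\cdots\otimes x_n)=\operatorname{Tr}\Big(\rho\,\mathcal E\big(x_1\otimes\mathcal E(x_2\otimes\cdots\otimes\mathcal E(x_n\otimes\mathbf 1)\cdots)\big)\Big).\qquad(*)$$ For $v\in I_\rho^c$ put $$\psi_v(x)=\frac1{\operatorname{Tr}(\rho_v)}\sum_{i\in\Lambda}\operatorname{Tr}\big((B^i_v\rho_vB^{i*}_v\otimes|i\rangle\langle i|)\,x\big).$$ **Theorem.** The series defining $\mathcal E(x\otimes y)$ converges strongly (unconditionally), and the series defining $\psi_v(x)$ converges absolutely. For all $n\ge1$ and all $x_1,\dots,x_n\in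 B(\mathcal H\otimes\mathcal K^\rho)$, the right-hand side of $(*)$ equals the (absolutely convergent) sum $$\sum_{v\in I^c_\rho}\operatorname{Tr}(\rho_v)\,\psi_v(x_1)\psi_v(x_2)\cdots\psi_v(x_n).$$ Consequently, every QMC $\varphi$ for the pair $(\rho,\mathcal E)$ satisfies $$\varphi(x_1\otimes\cdots\otimes x_n)=\sum_{v\in I^c_\rho}\operatorname{Tr}(\rho_v)\,\psi_v(x_1)\psi_v(x_2)\cdots\psi_v(x_n).$$ -/

import Mathlib

open scoped InnerProductSpace ComplexOrder

noncomputable section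

namespace OQRW

/-! ### Hilbert sums, block operators and strongly convergent series -/

/-- The Hilbert space `ℓ²(ι; E)`, i.e. the Hilbert tensor product `E ⊗ 𝒦` of `E` with the
Hilbert space `𝒦 = ℓ²(ι)`, whose canonical orthonormal basis is `(|i⟩)_{i ∈ ι}`; the vector
`u ⊗ |i⟩` is the element of `ℓ²(ι; E)` with value `u` at `i` and `0` elsewhere. -/
abbrev HilbertSum (ι E : Type*) [NormedAddCommGroup E] : Type _ := lp (fun _ : ι => E) 2

section Block

variable {E : Type*} [NormedAddCommGroup E] [InnerProductSpace ℂ E]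

open Classical in
/-- The operator `T ⊗ |i⟩⟨j|`, which sends `u ⊗ |k⟩` to `T u ⊗ |i⟩` if `k = j` and to `0`
otherwise. -/
def blockOp {ι κ : Type*} (i : ι) (j : κ) (T : E →L[ℂ] E) :
    HilbertSum κ E →L[ℂ] HilbertSum ι E :=
  lp.singleContinuousLinearMap ℂ (fun _ : ι => E) 2 i ∘L T ∘L
    lp.evalCLM ℂ (fun _ : κ => E) 2 j

/-- `T` is the unconditional sum of the operators `f i` in the strong operator topology. -/
def HasStrongSum {ι F G : Type*} [NormedAddCommGroup F] [NormedSpace ℂ F]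
    [NormedAddCommGroup G] [NormedSpace ℂ G] (f : ι → (F →L[ℂ] G)) (T : F →L[ℂ] G) : Prop :=
  ∀ u : F, HasSum (fun i => f i u) (T u)

open Classical in
/-- The sum of a family of operators in the strong operator topology
(by convention `0` if the series does not converge). -/
def strongSum {ι F G : Type*} [NormedAddCommGroup F] [NormedSpace ℂ F]
    [NormedAddCommGroup G] [NormedSpace ℂ G] (f : ι → (F →L[ℂ] G)) : F →L[ℂ] G :=
  if h : ∃ T, HasStrongSum f T then h.choose else 0

open Classical in
/-- The isometry `u ↦ u ⊗ |i⟩`. -/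
def ketIsometry {ι : Type*} (E : Type*) [NormedAddCommGroup E] [InnerProductSpace ℂ E] (i : ι) :
    E →ₗᵢ[ℂ] HilbertSum ι E where
  toLinearMap := lp.lsingle (𝕜 := ℂ) (E := fun _ : ι => E) 2 i
  norm_map' u := lp.norm_single (E := fun _ : ι => E) (p := 2) (by norm_num) i u

theorem ketIsometry_orthogonalFamily {ι : Type*} (S : Set ι) :
    OrthogonalFamily ℂ (fun _ : S => E) (fun s : S => ketIsometry E (s : ι)) := by
  classical
  intro s t hst u w
  have hne : (s : ι) ≠ t := fun h => hst (Subtype.ext h)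
  change ⟪lp.single (E := fun _ : ι => E) 2 (s : ι) u,
    lp.single (E := fun _ : ι => E) 2 (t : ι) w⟫_ℂ = 0
  rw [lp.inner_single_left]
  simp [Pi.single_eq_of_ne hne]

variable [CompleteSpace E]

/-- The canonical isometric embedding of `E ⊗ ℓ²(S)` into `E ⊗ ℓ²(ι)` for a set `S` of indices;
it sends `u ⊗ |s⟩` to `u ⊗ |s⟩`. -/
def inclusion {ι : Type*} (S : Set ι) : HilbertSum S E →ₗᵢ[ℂ] HilbertSum ι E :=
  (ketIsometry_orthogonalFamily (E := E) S).linearIsometry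

/-- The extension by zero of an operator on `E ⊗ ℓ²(S)` to `E ⊗ ℓ²(ι)`. -/
def extendZero {ι : Type*} (S : Set ι) (x : HilbertSum S E →L[ℂ] HilbertSum S E) :
    HilbertSum ι E →L[ℂ] HilbertSum ι E :=
  (inclusion S).toContinuousLinearMap ∘L x ∘L
    ContinuousLinearMap.adjoint (inclusion S).toContinuousLinearMap

end Block

/-! ### Trace and trace class operators -/

section Trace

variable {E : Type*} [NormedAddCommGroup E] [InnerProductSpace ℂ E] [CompleteSpace E]

/-- The index set of a fixed orthonormal (Hilbert) basis of `E`. -/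
def basisIndex (E : Type*) [NormedAddCommGroup E] [InnerProductSpace ℂ E] [CompleteSpace E] :
    Set E := (exists_hilbertBasis ℂ E).choose

/-- A fixed orthonormal (Hilbert) basis of `E`. -/
def stdBasis (E : Type*) [NormedAddCommGroup E] [InnerProductSpace ℂ E] [CompleteSpace E] :
    HilbertBasis (basisIndex E) ℂ E := (exists_hilbertBasis ℂ E).choose_spec.choose

/-- `T` is of trace class: `∑ ⟨e, |T| e⟩ < ∞`, where `|T| = (T* T)^{1/2}` and `e` runs through an
orthonormal basis (the condition does not depend on the basis). -/
def IsTraceClass (T : E →L[ℂ] E) : Prop :=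
  Summable fun k => ⟪stdBasis E k, CFC.abs T (stdBasis E k)⟫_ℂ

/-- The trace `∑ ⟨e, T e⟩` of a trace class operator, where `e` runs through an orthonormal basis
(the value does not depend on the basis). -/
def tr (T : E →L[ℂ] E) : ℂ :=
  ∑' k, ⟪stdBasis E k, T (stdBasis E k)⟫_ℂ

end Trace

/-! ### The infinite tensor product of copies of `B(E)` -/

section TensorProduct

variable {E : Type*} [NormedAddCommGroup E] [InnerProductSpace ℂ E]

theorem memℓp_comp {X : Type*} (a : E →L[ℂ] E) (f : HilbertSum X E) :
    Memℓp (fun x => a (f x)) 2 := by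
  have hf := lp.memℓp f
  rw [memℓp_gen_iff (by norm_num)] at hf ⊢
  refine Summable.of_nonneg_of_le (fun x => by positivity) (fun x => ?_)
    (hf.mul_left (‖a‖ ^ (2 : ENNReal).toReal))
  rw [← Real.mul_rpow (norm_nonneg _) (norm_nonneg _)]
  exact Real.rpow_le_rpow (norm_nonneg _) (a.le_opNorm _) (by norm_num)

/-- The operator `a ⊗ 1` on `E ⊗ ℓ²(X)`, as a bounded operator. -/
def ampOp {X : Type*} (a : E →L[ℂ] E) : HilbertSum X E →L[ℂ] HilbertSum X E :=
  LinearMap.mkContinuous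
    { toFun := fun f => (⟨fun x => a (f x), memℓp_comp a f⟩ : HilbertSum X E)
      map_add' := fun f g => by
        ext x
        exact map_add a (f x) (g x)
      map_smul' := fun c f => by
        ext x
        exact map_smul a c (f x) }
    ‖a‖ (fun f => by
      refine lp.norm_le_of_tsum_le (p := 2) (by norm_num) (by positivity) ?_
      rw [Real.mul_rpow (norm_nonneg _) (norm_nonneg _),
        lp.norm_rpow_eq_tsum (p := 2) (by norm_num) f, ← tsum_mul_left]
      have hf := lp.memℓp f
      have hg := memℓp_comp a f
      rw [memℓp_gen_iff (by norm_num)] at hf hg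
      refine hg.tsum_le_tsum (fun x => ?_) (hf.mul_left _)
      rw [← Real.mul_rpow (norm_nonneg _) (norm_nonneg _)]
      exact Real.rpow_le_rpow (norm_nonneg _) (a.le_opNorm _) (by norm_num))

@[simp]
theorem ampOp_apply {X : Type*} (a : E →L[ℂ] E) (f : HilbertSum X E) (x : X) :
    ampOp a f x = a (f x) := rfl

variable [CompleteSpace E]

/-- The amplification `a ↦ a ⊗ 1` from `B(E)` to `B(E ⊗ ℓ²(X))`, as a unital *-homomorphism. -/
def amplification (E : Type*) [NormedAddCommGroup E] [InnerProductSpace ℂ E] [CompleteSpace E]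
    (X : Type*) :
    (E →L[ℂ] E) →⋆ₐ[ℂ] (HilbertSum X E →L[ℂ] HilbertSum X E) where
  toFun := ampOp
  map_one' := by ext f x; rfl
  map_mul' a b := by ext f x; rfl
  map_zero' := by ext f x; rfl
  map_add' a b := by ext f x; rfl
  commutes' c := by ext f x; rfl
  map_star' a := by
    rw [ContinuousLinearMap.star_eq_adjoint, ContinuousLinearMap.star_eq_adjoint,
      ContinuousLinearMap.eq_adjoint_iff]
    intro f g
    rw [lp.inner_eq_tsum, lp.inner_eq_tsum]
    exact tsum_congr fun x => ContinuousLinearMap.adjoint_inner_left a (g x) (f x)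

/-- The Hilbert space `ℓ²(ℕ → β)`, where `β` indexes an orthonormal basis `(e_b)` of `E`. Its
canonical basis vector at `s : ℕ → β` plays the role of `e_{s 0} ⊗ e_{s 1} ⊗ ⋯`. -/
abbrev ChainSpace (E : Type*) [NormedAddCommGroup E] [InnerProductSpace ℂ E] [CompleteSpace E] :
    Type _ := HilbertSum (ℕ → basisIndex E) ℂ

open Classical in
/-- For `s : ℕ → β` the vector `e_{s k} ⊗ |s off k⟩` of `E ⊗ ℓ²({n // n ≠ k} → β)`. -/
def slotVector (E : Type*) [NormedAddCommGroup E] [InnerProductSpace ℂ E] [CompleteSpace E]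
    (k : ℕ) (s : ℕ → basisIndex E) : HilbertSum ({n : ℕ // n ≠ k} → basisIndex E) E :=
  lp.single 2 (fun n => s n.1) (stdBasis E (s k))

theorem slotVector_orthonormal (k : ℕ) : Orthonormal ℂ (slotVector E k) := by
  classical
  rw [orthonormal_iff_ite]
  intro s t
  unfold slotVector
  rw [lp.inner_single_left]
  by_cases hst : (fun n : {n : ℕ // n ≠ k} => s n.1) = fun n => t n.1
  · rw [hst, lp.single_apply_self, orthonormal_iff_ite.1 (stdBasis E).orthonormal]
    refine if_congr ⟨fun h => ?_, fun h => by rw [h]⟩ rfl rfl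
    funext n
    by_cases hn : n = k
    · rw [hn, h]
    · exact congrFun hst ⟨n, hn⟩
  · rw [lp.single_apply_ne _ _ _ hst, inner_zero_right, if_neg]
    rintro rfl
    exact hst rfl

theorem slotVector_span (k : ℕ) : (Submodule.span ℂ (Set.range (slotVector E k)))ᗮ = ⊥ := by
  classical
  rw [Submodule.eq_bot_iff]
  intro f hf
  ext r
  have h0 : ∀ b, ⟪stdBasis E b, f r⟫_ℂ = 0 := by
    intro b
    let s : ℕ → basisIndex E := fun n => if h : n = k then b else r ⟨n, h⟩
    have hs := (Submodule.mem_orthogonal _ _).1 hf (slotVector E k s)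
      (Submodule.subset_span ⟨s, rfl⟩)
    have h1 : (fun n : {n : ℕ // n ≠ k} => s n.1) = r := by
      funext n
      simp [s, n.2]
    have h2 : s k = b := by simp [s]
    unfold slotVector at hs
    rw [lp.inner_single_left, h1, h2] at hs
    exact hs
  have h3 : (stdBasis E).repr (f r) = 0 := by
    ext b
    rw [HilbertBasis.repr_apply_apply, h0 b]
    rfl
  simpa using h3

/-- The canonical unitary from `E ⊗ ℓ²({n // n ≠ k} → β)` onto `ℓ²(ℕ → β)`, which singles out
the `k`-th tensor factor. -/
def slotUnitary (E : Type*) [NormedAddCommGroup E] [InnerProductSpace ℂ E] [CompleteSpace E]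
    (k : ℕ) : HilbertSum ({n : ℕ // n ≠ k} → basisIndex E) E ≃ₗᵢ[ℂ] ChainSpace E :=
  (HilbertBasis.mkOfOrthogonalEqBot (slotVector_orthonormal (E := E) k) (slotVector_span k)).repr

/-- The operator `1 ⊗ ⋯ ⊗ 1 ⊗ a ⊗ 1 ⊗ ⋯` on `ℓ²(ℕ → β)` with `a` in the `k`-th factor. -/
def slotOp (E : Type*) [NormedAddCommGroup E] [InnerProductSpace ℂ E] [CompleteSpace E] (k : ℕ) :
    (E →L[ℂ] E) →⋆ₐ[ℂ] (ChainSpace E →L[ℂ] ChainSpace E) :=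
  StarAlgHom.comp ((slotUnitary E k).conjStarAlgEquiv).toStarAlgHom (amplification E _)

/-- The infinite (spatial) C*-tensor product `⨂_{k ∈ ℕ} B(E)`, i.e. the norm closure of the
*-algebra generated by the copies of `B(E)` in the single factors. -/
def chainAlgebra (E : Type*) [NormedAddCommGroup E] [InnerProductSpace ℂ E] [CompleteSpace E] :
    StarSubalgebra ℂ (ChainSpace E →L[ℂ] ChainSpace E) :=
  (StarAlgebra.adjoin ℂ (⋃ k : ℕ, Set.range (slotOp E k))).topologicalClosure

/-- The canonical injection `J_k` of `B(E)` into the `k`-th factor of `⨂_{k ∈ ℕ} B(E)`. -/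
def inj (E : Type*) [NormedAddCommGroup E] [InnerProductSpace ℂ E] [CompleteSpace E] (k : ℕ) :
    (E →L[ℂ] E) →⋆ₐ[ℂ] chainAlgebra E :=
  StarAlgHom.codRestrict (slotOp E k) (chainAlgebra E) fun a =>
    StarSubalgebra.le_topologicalClosure _
      (StarAlgebra.subset_adjoin ℂ _ (Set.mem_iUnion.2 ⟨k, a, rfl⟩))

/-- `x_0 ⊗ x_1 ⊗ ⋯ ⊗ x_{n-1} ⊗ 1 ⊗ ⋯ = J_0(x_0) J_1(x_1) ⋯ J_{n-1}(x_{n-1})`. -/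
def pureTensor {n : ℕ} (x : Fin n → (E →L[ℂ] E)) : chainAlgebra E :=
  (List.ofFn fun k : Fin n => inj E k (x k)).prod

/-! ### Quantum Markov chains -/

/-- A state: a positive linear functional taking the value `1` at the identity. -/
structure IsState {A : Type*} [Ring A] [StarRing A] [Algebra ℂ A] (φ : A →ₗ[ℂ] ℂ) : Prop where
  nonneg : ∀ a : A, 0 ≤ φ (star a * a)
  map_one : φ 1 = 1

/-- `φ₀(𝓔(x_0 ⊗ 𝓔(x_1 ⊗ ⋯ 𝓔(x_{n-1} ⊗ 1) ⋯)))`, where `𝓔 x y` stands for `𝓔(x ⊗ y)`. -/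
def markovValue (φ₀ : (E →L[ℂ] E) → ℂ) (𝓔 : (E →L[ℂ] E) → (E →L[ℂ] E) → (E →L[ℂ] E))
    {n : ℕ} (x : Fin n → (E →L[ℂ] E)) : ℂ :=
  φ₀ ((List.ofFn x).foldr 𝓔 1)

/-- `φ` is a quantum Markov chain on `⨂_{k ∈ ℕ} B(E)` associated with the pair `(φ₀, 𝓔)`. -/
structure IsQuantumMarkovChain (φ₀ : (E →L[ℂ] E) → ℂ)
    (𝓔 : (E →L[ℂ] E) → (E →L[ℂ] E) → (E →L[ℂ] E)) (φ : chainAlgebra E →ₗ[ℂ] ℂ) : Prop where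
  isState : IsState φ
  map_pureTensor : ∀ (n : ℕ) (x : Fin (n + 1) → (E →L[ℂ] E)),
    φ (pureTensor x) = markovValue φ₀ 𝓔 x

end TensorProduct

/-! ### The quantum Markov chain of an open quantum random walk -/

section Walk

variable {Λ H : Type*} [NormedAddCommGroup H] [InnerProductSpace ℂ H] [CompleteSpace H]

/-- `B i j` (which is `B^i_j`, the effect of passing from `j` to `i`) are the coefficients of an
open quantum random walk: `∑_i (B^i_j)* B^i_j = 1` strongly, for each `j`. -/
def IsWalk (B : Λ → Λ → (H →L[ℂ] H)) : Prop :=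
  ∀ j, HasStrongSum (fun i => ContinuousLinearMap.adjoint (B i j) ∘L B i j) 1

/-- The family `(ρ_i)` defines a density operator `ρ = ∑_i ρ_i ⊗ |i⟩⟨i|`. -/
structure IsBlockDensity (ρ : Λ → (H →L[ℂ] H)) : Prop where
  isPositive : ∀ i, (ρ i).IsPositive
  isTraceClass : ∀ i, IsTraceClass (ρ i)
  hasSum_tr : HasSum (fun i => tr (ρ i)) 1

/-- The complement of `I_ρ = {i | ρ_i = 0}`. -/
def siteSupport (ρ : Λ → (H →L[ℂ] H)) : Set Λ := {i | ρ i ≠ 0}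

/-- The Hilbert space `H ⊗ 𝒦^ρ`, where `𝒦^ρ` is spanned by the `|i⟩` with `ρ_i ≠ 0`. -/
abbrev WalkSpace (ρ : Λ → (H →L[ℂ] H)) : Type _ := HilbertSum (siteSupport ρ) H

/-- The algebra `B(H ⊗ 𝒦^ρ)`. -/
abbrev WalkAlg (ρ : Λ → (H →L[ℂ] H)) : Type _ := WalkSpace ρ →L[ℂ] WalkSpace ρ

/-- The density operator `ρ = ∑_i ρ_i ⊗ |i⟩⟨i|` on `H ⊗ 𝒦^ρ`. -/
def densityOp (ρ : Λ → (H →L[ℂ] H)) : WalkAlg ρ :=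
  strongSum fun i : siteSupport ρ => blockOp i i (ρ i)

/-- The operator `M^i_j = B^i_j ⊗ |i⟩⟨j| : H ⊗ 𝒦^ρ → H ⊗ 𝒦`, for a site `i` and a site `j`
with `ρ_j ≠ 0`. -/
def stepOp (B : Λ → Λ → (H →L[ℂ] H)) (ρ : Λ → (H →L[ℂ] H)) (i : Λ) (j : siteSupport ρ) :
    WalkSpace ρ →L[ℂ] HilbertSum Λ H :=
  blockOp i j (B i j)

/-- The term of index `(i, j)` of `𝓔(x ⊗ y)`, that is
`M^{i*}_j x M^i_j · Tr((ρ_j ⊗ |j⟩⟨j|) y) / Tr(ρ_j)`. Here `x ∈ B(H ⊗ 𝒦^ρ)` is viewed as an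
operator on `H ⊗ 𝒦`, acting as `0` on the orthogonal complement of `H ⊗ 𝒦^ρ`. -/
def transitionTerm (B : Λ → Λ → (H →L[ℂ] H)) (ρ : Λ → (H →L[ℂ] H)) (x y : WalkAlg ρ)
    (p : Λ × siteSupport ρ) : WalkAlg ρ :=
  (tr (blockOp p.2 p.2 (ρ p.2) ∘L y) / tr (ρ p.2)) •
    (ContinuousLinearMap.adjoint (stepOp B ρ p.1 p.2) ∘L
      extendZero (siteSupport ρ) x ∘L stepOp B ρ p.1 p.2)

/-- The transition expectation
`𝓔(x ⊗ y) = ∑_{i,j} M^{i*}_j x M^i_j · Tr((ρ_j ⊗ |j⟩⟨j|) y) / Tr(ρ_j)`, a strong sum. -/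
def transitionExpectation (B : Λ → Λ → (H →L[ℂ] H)) (ρ : Λ → (H →L[ℂ] H)) (x y : WalkAlg ρ) :
    WalkAlg ρ :=
  strongSum (transitionTerm B ρ x y)

/-- The initial functional `x ↦ Tr(ρ x)`. -/
def initialState (ρ : Λ → (H →L[ℂ] H)) (x : WalkAlg ρ) : ℂ := tr (densityOp ρ ∘L x)

/-- `Tr((B^i_v ρ_v B^{i*}_v ⊗ |i⟩⟨i|) x)`, the trace being taken on `H ⊗ 𝒦`. -/
def psiTerm (B : Λ → Λ → (H →L[ℂ] H)) (ρ : Λ → (H →L[ℂ] H)) (v : siteSupport ρ) (x : WalkAlg ρ)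
    (i : Λ) : ℂ :=
  tr (blockOp i i (B i v ∘L ρ v ∘L ContinuousLinearMap.adjoint (B i v)) ∘L
    extendZero (siteSupport ρ) x)

/-- `ψ_v(x) = Tr(ρ_v)⁻¹ ∑_i Tr((B^i_v ρ_v B^{i*}_v ⊗ |i⟩⟨i|) x)`. -/
def psi (B : Λ → Λ → (H →L[ℂ] H)) (ρ : Λ → (H →L[ℂ] H)) (v : siteSupport ρ) (x : WalkAlg ρ) : ℂ :=
  (tr (ρ v))⁻¹ * ∑' i, psiTerm B ρ v x i

end Walk

end OQRW

end

/-! The chain factorizes because `M^i_j` annihilates every site except `j`. Testing `𝓔(x ⊗ y)`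
against `ρ_v ⊗ |v⟩⟨v|` therefore keeps only the terms with `j = v`, and these give `ψ_v(x) Tr((ρ_v ⊗
|v⟩⟨v|) y)` (`siteState_transitionExpectation`). Induction along the nested `𝓔`, starting from the
value `Tr(ρ_v)` at `1`, yields the product of the `ψ_v`. Summing over `v` recovers `Tr(ρ ·)`, and a
QMC takes this value by definition.

The analysis rests on two devices. Writing a positive trace class `T` as `∑ |u n⟩⟨u n|` with
square-summable `u` turns `Tr(T X)` into the absolutely convergent sum `∑ ⟨u n, X (u n)⟩`
(`HasRankOneSum.hasSum_tr`), so that sums can be exchanged. A series `∑ V_p* W_p` converges strongly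
once the columns `(V_p)` and `(W_p)` are bounded (`exists_hasStrongSum_adjoint_comp`). -/

noncomputable section

namespace OQRW

/-! ### Rank-one expansions and traces -/

section RankOne

variable {E F : Type*} [NormedAddCommGroup E] [InnerProductSpace ℂ E]
  [NormedAddCommGroup F] [InnerProductSpace ℂ F]

theorem HasStrongSum.hasStrongSum_strongSum {ι : Type*} {f : ι → F →L[ℂ] E} {T : F →L[ℂ] E}
    (h : HasStrongSum f T) : HasStrongSum f (strongSum f) := by
  have hex : ∃ T, HasStrongSum f T := ⟨T, h⟩
  rw [strongSum, dif_pos hex]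
  exact hex.choose_spec

theorem hilbertBasis_hasSum_norm_inner_sq {κ : Type*} (b : HilbertBasis κ ℂ E) (z : E) :
    HasSum (fun k => ‖⟪b k, z⟫_ℂ‖ ^ 2) (‖z‖ ^ 2) := by
  have h := b.hasSum_inner_mul_inner z z
  rw [← Complex.hasSum_ofReal]
  convert! h using 1
  · funext k
    rw [← inner_conj_symm z (b k), Complex.conj_mul']
    norm_cast
  · rw [inner_self_eq_norm_sq_to_K]
    norm_cast

theorem hilbertSum_hasSum_norm_sq {ι : Type*} (z : HilbertSum ι E) :
    HasSum (fun i => ‖z i‖ ^ 2) (‖z‖ ^ 2) := by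
  have h := lp.hasSum_inner (𝕜 := ℂ) z z
  rw [← Complex.hasSum_ofReal]
  convert! h using 1
  · funext i
    rw [inner_self_eq_norm_sq_to_K]
    norm_cast
  · rw [inner_self_eq_norm_sq_to_K]
    norm_cast

/-- `T = ∑ n, |u n⟩⟨u n|` strongly, with `∑ n, ‖u n‖ ^ 2 < ∞`. -/
structure HasRankOneSum {κ : Type*} (u : κ → E) (T : E →L[ℂ] E) : Prop where
  summable : Summable fun n => ‖u n‖ ^ 2
  hasSum : ∀ z, HasSum (fun n => ⟪u n, z⟫_ℂ • u n) (T z)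

theorem norm_inner_apply_le (X : E →L[ℂ] E) (z : E) : ‖⟪z, X z⟫_ℂ‖ ≤ ‖X‖ * ‖z‖ ^ 2 := by
  refine (norm_inner_le_norm _ _).trans ?_
  nlinarith [X.le_opNorm z, norm_nonneg z]

theorem summable_norm_inner_apply {κ : Type*} {u : κ → E} (hu : Summable fun n => ‖u n‖ ^ 2)
    (X : E →L[ℂ] E) : Summable fun n => ⟪u n, X (u n)⟫_ℂ :=
  .of_norm_bounded (hu.mul_left ‖X‖) fun n => norm_inner_apply_le X (u n)

theorem summable_norm_inner_sq_prod {κ μ : Type*} (b : HilbertBasis μ ℂ E) {w : κ → E}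
    (hw : Summable fun n => ‖w n‖ ^ 2) :
    Summable fun p : κ × μ => ‖⟪b p.2, w p.1⟫_ℂ‖ ^ 2 := by
  rw [summable_prod_of_nonneg fun p => by positivity]
  refine ⟨fun n => (hilbertBasis_hasSum_norm_inner_sq b (w n)).summable, ?_⟩
  simpa only [(hilbertBasis_hasSum_norm_inner_sq b (w _)).tsum_eq] using hw

variable [CompleteSpace E] [CompleteSpace F]

theorem HasRankOneSum.conj {κ : Type*} {u : κ → E} {T : E →L[ℂ] E} (h : HasRankOneSum u T)
    (A : E →L[ℂ] F) :
    HasRankOneSum (fun n => A (u n)) (A ∘L T ∘L ContinuousLinearMap.adjoint A) where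
  summable := by
    refine .of_nonneg_of_le (fun n => by positivity) (fun n => ?_) (h.summable.mul_left (‖A‖ ^ 2))
    rw [← mul_pow]
    exact pow_le_pow_left₀ (norm_nonneg _) (A.le_opNorm _) 2
  hasSum z := by
    convert! (h.hasSum (ContinuousLinearMap.adjoint A z)).mapL A using 1
    funext n
    rw [map_smul, ContinuousLinearMap.adjoint_inner_right]

/-- Since `|u n⟩⟨u n|` has norm `‖u n‖ ^ 2`, the series converges absolutely even in operator norm.
-/
theorem exists_hasRankOneSum {κ : Type*} {u : κ → E} (hu : Summable fun n => ‖u n‖ ^ 2) :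
    ∃ T, HasRankOneSum u T := by
  have h : Summable fun n => (innerSL ℂ (u n)).smulRight (u n) := by
    refine .of_norm_bounded hu fun n => ?_
    rw [ContinuousLinearMap.norm_smulRight_apply, innerSL_apply_norm, sq]
  exact ⟨_, hu, fun z => h.hasSum.mapL (ContinuousLinearMap.apply ℂ E z)⟩

/-- `Tr (T X) = ∑ n, ⟨u n, X (u n)⟩` if `T = ∑ n, |u n⟩⟨u n|`. -/
theorem HasRankOneSum.hasSum_tr {κ : Type*} {u : κ → E} {T : E →L[ℂ] E}
    (h : HasRankOneSum u T) (X : E →L[ℂ] E) :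
    HasSum (fun n => ⟪u n, X (u n)⟫_ℂ) (tr (T ∘L X)) := by
  set b := stdBasis E
  -- Fubini for this array: summing over the basis gives `⟨u n, X (u n)⟩` by Parseval, summing over
  -- `n` gives the diagonal entries of `T X`.
  set f : κ × basisIndex E → ℂ := fun p => ⟪u p.1, X (b p.2)⟫_ℂ * ⟪b p.2, u p.1⟫_ℂ
  have hX : Summable fun n => ‖ContinuousLinearMap.adjoint X (u n)‖ ^ 2 := by
    refine .of_nonneg_of_le (fun n => by positivity) (fun n => ?_)
      (h.summable.mul_left (‖ContinuousLinearMap.adjoint X‖ ^ 2))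
    rw [← mul_pow]
    exact pow_le_pow_left₀ (norm_nonneg _) (ContinuousLinearMap.le_opNorm _ _) 2
  have hf : Summable f := by
    -- Domination by `a * c ≤ a ^ 2 + c ^ 2`, where `X` has been moved onto `u n` so that Parseval
    -- applies to both squares.
    refine .of_norm_bounded ((summable_norm_inner_sq_prod b hX).add
      (summable_norm_inner_sq_prod b h.summable)) fun p => ?_
    have e : ‖⟪u p.1, X (b p.2)⟫_ℂ‖ = ‖⟪b p.2, ContinuousLinearMap.adjoint X (u p.1)⟫_ℂ‖ := by
      rw [← ContinuousLinearMap.adjoint_inner_left, norm_inner_symm]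
    rw [norm_mul, e]
    nlinarith [sq_nonneg (‖⟪b p.2, ContinuousLinearMap.adjoint X (u p.1)⟫_ℂ‖
      - ‖⟪b p.2, u p.1⟫_ℂ‖), sq_nonneg ‖⟪b p.2, ContinuousLinearMap.adjoint X (u p.1)⟫_ℂ‖,
      sq_nonneg ‖⟪b p.2, u p.1⟫_ℂ‖]
  have h1 : ∀ n, HasSum (fun k => f (n, k)) ⟪u n, X (u n)⟫_ℂ := by
    intro n
    have := b.hasSum_inner_mul_inner (ContinuousLinearMap.adjoint X (u n)) (u n)
    simpa only [ContinuousLinearMap.adjoint_inner_left] using this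
  have h2 : ∀ k, HasSum (fun n => f (n, k)) ⟪b k, (T ∘L X) (b k)⟫_ℂ := by
    intro k
    convert! (h.hasSum (X (b k))).mapL (innerSL ℂ (b k)) using 1
    funext n
    simp [f]
  have h3 := hf.hasSum.prod_fiberwise h1
  have h4 := (hf.prod_symm.hasSum.prod_fiberwise h2).tsum_eq
  have h5 : ∑' p, f p = ∑' p : basisIndex E × κ, f p.swap :=
    ((Equiv.prodComm _ _).tsum_eq f).symm
  rw [h5] at h3
  rwa [tr, h4]

/-- A positive trace class operator `T` is the sum of the rank one operators given by
`√T (e k)`, where `e` is an orthonormal basis. -/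
theorem hasRankOneSum_sqrt {T : E →L[ℂ] E} (hT : T.IsPositive) (htr : IsTraceClass T) :
    HasRankOneSum (fun k => CFC.sqrt T (stdBasis E k)) T := by
  have h0 : 0 ≤ T := (ContinuousLinearMap.nonneg_iff_isPositive T).2 hT
  set R := CFC.sqrt T
  have hR : R * R = T := CFC.sqrt_mul_sqrt_self T h0
  have hRs : ∀ z w, ⟪R z, w⟫_ℂ = ⟪z, R w⟫_ℂ :=
    ((ContinuousLinearMap.nonneg_iff_isPositive R).1 (CFC.sqrt_nonneg T)).isSymmetric
  have hRR : ∀ z, R (R z) = T z := fun z => DFunLike.congr_fun hR z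
  constructor
  · rw [IsTraceClass, CFC.abs_of_nonneg T h0] at htr
    rw [← Complex.summable_ofReal]
    refine htr.congr fun k => ?_
    rw [← hRR, ← hRs, inner_self_eq_norm_sq_to_K]
    norm_cast
  · intro z
    rw [← hRR]
    convert! ((stdBasis E).hasSum_repr (R z)).mapL R using 1
    funext k
    rw [map_smul, HilbertBasis.repr_apply_apply, hRs]

/-- Grouping an unconditional sum by fibers keeps its value; uniqueness of limits identifies it with
the chosen `strongSum`. -/
theorem HasRankOneSum.of_sigma {ι : Type*} {κ : ι → Type*} {u : (Σ i, κ i) → E}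
    {T : ι → E →L[ℂ] E} (hu : Summable fun n => ‖u n‖ ^ 2)
    (h : ∀ i, HasRankOneSum (fun k => u ⟨i, k⟩) (T i)) :
    HasRankOneSum u (strongSum T) := by
  obtain ⟨S, hS⟩ := exists_hasRankOneSum hu
  have hT : HasStrongSum T S := fun z => (hS.hasSum z).sigma fun i => (h i).hasSum z
  have : strongSum T = S := by
    ext z
    exact (hT.hasStrongSum_strongSum z).unique (hT z)
  rwa [this]

end RankOne

/-! ### Strong convergence through column operators -/

section StrongSum

variable {F G : Type*} [NormedAddCommGroup F] [InnerProductSpace ℂ F]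
  [NormedAddCommGroup G] [InnerProductSpace ℂ G]

/-- The operator `z ↦ (V p z)_p` into the Hilbert sum. -/
theorem exists_columnOp {P : Type*} (V : P → F →L[ℂ] G) (C : ℝ)
    (hV : ∀ z, Summable fun p => ‖V p z‖ ^ 2)
    (hC : ∀ z, ∑' p, ‖V p z‖ ^ 2 ≤ C * ‖z‖ ^ 2) :
    ∃ W : F →L[ℂ] HilbertSum P G, ∀ z p, W z p = V p z := by
  have hmem : ∀ z, Memℓp (fun p => V p z) 2 := fun z => by
    rw [memℓp_gen_iff (by norm_num)]
    simpa using hV z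
  let L : F →ₗ[ℂ] HilbertSum P G :=
    { toFun := fun z => ⟨fun p => V p z, hmem z⟩
      map_add' := fun y z => by
        ext p
        exact map_add (V p) y z
      map_smul' := fun c z => by
        ext p
        exact map_smul (V p) c z }
  -- The absolute value avoids assuming `0 ≤ C`, which can fail when `F` is trivial.
  refine ⟨L.mkContinuous (Real.sqrt |C|) fun z => ?_, fun z p => rfl⟩
  refine abs_le_of_sq_le_sq' ?_ (by positivity) |>.2
  rw [mul_pow, Real.sq_sqrt (abs_nonneg C), ← (hilbertSum_hasSum_norm_sq (L z)).tsum_eq]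
  exact (hC z).trans (by gcongr; exact le_abs_self C)

variable [CompleteSpace F] [CompleteSpace G]

/-- The sum is `V'* W'` for the column operators `V'`, `W'`: apply the bounded `V'*` to the
unconditional coordinate expansion of `W' z`. -/
theorem exists_hasStrongSum_adjoint_comp {P : Type*} (V W : P → F →L[ℂ] G) (C D : ℝ)
    (hV : ∀ z, Summable fun p => ‖V p z‖ ^ 2)
    (hC : ∀ z, ∑' p, ‖V p z‖ ^ 2 ≤ C * ‖z‖ ^ 2)
    (hW : ∀ z, Summable fun p => ‖W p z‖ ^ 2)
    (hD : ∀ z, ∑' p, ‖W p z‖ ^ 2 ≤ D * ‖z‖ ^ 2) :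
    ∃ T, HasStrongSum (fun p => ContinuousLinearMap.adjoint (V p) ∘L W p) T := by
  classical
  obtain ⟨V', hV'⟩ := exists_columnOp V C hV hC
  obtain ⟨W', hW'⟩ := exists_columnOp W D hW hD
  refine ⟨ContinuousLinearMap.adjoint V' ∘L W', fun z => ?_⟩
  convert! (lp.hasSum_single (p := 2) (by norm_num) (W' z)).mapL
    (ContinuousLinearMap.adjoint V') using 1
  funext p
  refine ext_inner_left ℂ fun y => ?_
  rw [ContinuousLinearMap.comp_apply, ContinuousLinearMap.adjoint_inner_right,
    ContinuousLinearMap.adjoint_inner_right, lp.inner_single_right, hV', hW']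

end StrongSum

/-! ### Embeddings of single sites -/

section Ket

variable {E : Type*} [NormedAddCommGroup E] [InnerProductSpace ℂ E]

theorem ketIsometry_apply_self {ι : Type*} (i : ι) (u : E) : ketIsometry E i u i = u := by
  classical
  exact lp.single_apply_self (E := fun _ : ι => E) 2 i u

theorem ketIsometry_apply_ne {ι : Type*} {i j : ι} (h : j ≠ i) (u : E) :
    ketIsometry E i u j = 0 := by
  classical
  exact lp.single_apply_ne (E := fun _ : ι => E) 2 i u h

variable [CompleteSpace E]

theorem adjoint_ketIsometry_apply {ι : Type*} (i : ι) (z : HilbertSum ι E) :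
    ContinuousLinearMap.adjoint (ketIsometry E i).toContinuousLinearMap z = z i := by
  classical
  refine ext_inner_left ℂ fun u => ?_
  rw [ContinuousLinearMap.adjoint_inner_right]
  exact lp.inner_single_left (𝕜 := ℂ) (G := fun _ : ι => E) i u z

theorem HasRankOneSum.blockOp {ι κ : Type*} {u : κ → E} {T : E →L[ℂ] E}
    (h : HasRankOneSum u T) (i : ι) :
    HasRankOneSum (fun n => ketIsometry E i (u n)) (blockOp i i T) := by
  convert! h.conj (ketIsometry E i).toContinuousLinearMap using 1
  ext1 z
  simp only [ContinuousLinearMap.comp_apply, adjoint_ketIsometry_apply]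
  rfl

end Ket

/-! ### Site functionals and the transition expectation -/

section Walk

variable {Λ H : Type*} [NormedAddCommGroup H] [InnerProductSpace ℂ H]
  {B : Λ → Λ → (H →L[ℂ] H)} {ρ : Λ → (H →L[ℂ] H)}

theorem stepOp_apply (i : Λ) (j : siteSupport ρ) (z : WalkSpace ρ) :
    stepOp B ρ i j z = ketIsometry H i (B i j (z j)) := rfl

variable [CompleteSpace H]

theorem IsWalk.hasSum_norm_sq (hB : IsWalk B) (j : Λ) (u : H) :
    HasSum (fun i => ‖B i j u‖ ^ 2) (‖u‖ ^ 2) := by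
  have h := (hB j u).mapL (innerSL ℂ u)
  rw [← Complex.hasSum_ofReal]
  convert! h using 1
  · funext i
    rw [innerSL_apply_apply, ContinuousLinearMap.comp_apply,
      ContinuousLinearMap.adjoint_inner_right, inner_self_eq_norm_sq_to_K]
    norm_cast
  · rw [innerSL_apply_apply, one_apply_eq_self, inner_self_eq_norm_sq_to_K]
    norm_cast

/-- The column of all `M^i_j` is an isometry: summing over `i` gives `‖z j‖ ^ 2` by the walk
condition, and then `j` runs over the coordinates of `z`. -/
theorem IsWalk.hasSum_norm_stepOp_sq (hB : IsWalk B) (z : WalkSpace ρ) :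
    HasSum (fun p : Λ × siteSupport ρ => ‖stepOp B ρ p.1 p.2 z‖ ^ 2) (‖z‖ ^ 2) := by
  have h1 : ∀ j : siteSupport ρ, HasSum (fun i => ‖stepOp B ρ i j z‖ ^ 2) (‖z j‖ ^ 2) := by
    intro j
    simpa only [stepOp_apply, LinearIsometry.norm_map] using hB.hasSum_norm_sq j (z j)
  have hs : Summable fun p : siteSupport ρ × Λ => ‖stepOp B ρ p.2 p.1 z‖ ^ 2 := by
    rw [summable_prod_of_nonneg fun p => by positivity]
    refine ⟨fun j => (h1 j).summable, ?_⟩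
    simpa only [(h1 _).tsum_eq] using (hilbertSum_hasSum_norm_sq z).summable
  have h := hs.hasSum
  rw [(h.prod_fiberwise h1).unique (hilbertSum_hasSum_norm_sq z)] at h
  exact (Equiv.prodComm Λ (siteSupport ρ)).hasSum_iff.2 h

/-- The vectors `√ρ_v (e k) ⊗ |v⟩`, where `e` is an orthonormal basis of `H`. -/
def siteVector (ρ : Λ → (H →L[ℂ] H)) (v : siteSupport ρ) (k : basisIndex H) : WalkSpace ρ :=
  ketIsometry H v (CFC.sqrt (ρ v) (stdBasis H k))

/-- The functional `x ↦ Tr((ρ_v ⊗ |v⟩⟨v|) x)`. -/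
def siteState (ρ : Λ → (H →L[ℂ] H)) (v : siteSupport ρ) (x : WalkAlg ρ) : ℂ :=
  tr (blockOp v v (ρ v) ∘L x)

namespace IsBlockDensity

variable (hρ : IsBlockDensity ρ)
include hρ

theorem hasRankOneSum (i : Λ) :
    HasRankOneSum (fun k => CFC.sqrt (ρ i) (stdBasis H k)) (ρ i) :=
  hasRankOneSum_sqrt (hρ.isPositive i) (hρ.isTraceClass i)

theorem hasRankOneSum_siteVector (v : siteSupport ρ) :
    HasRankOneSum (siteVector ρ v) (blockOp v v (ρ v)) :=
  (hρ.hasRankOneSum v).blockOp v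

theorem hasSum_siteState (v : siteSupport ρ) (x : WalkAlg ρ) :
    HasSum (fun k => ⟪siteVector ρ v k, x (siteVector ρ v k)⟫_ℂ) (siteState ρ v x) :=
  (hρ.hasRankOneSum_siteVector v).hasSum_tr x

theorem hasSum_norm_sqrt_sq (i : Λ) :
    HasSum (fun k => ((‖CFC.sqrt (ρ i) (stdBasis H k)‖ ^ 2 : ℝ) : ℂ)) (tr (ρ i)) := by
  convert! (hρ.hasRankOneSum i).hasSum_tr 1 using 1
  funext k
  rw [one_apply_eq_self, inner_self_eq_norm_sq_to_K]
  norm_cast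

theorem siteState_one (v : siteSupport ρ) : siteState ρ v 1 = tr (ρ v) := by
  refine (hρ.hasSum_siteState v 1).unique ?_
  convert! hρ.hasSum_norm_sqrt_sq v using 1
  funext k
  rw [one_apply_eq_self, inner_self_eq_norm_sq_to_K, siteVector,
    LinearIsometry.norm_map]
  norm_cast

theorem hasSum_norm_sqrt_sq_real (i : Λ) :
    HasSum (fun k => ‖CFC.sqrt (ρ i) (stdBasis H k)‖ ^ 2) (‖tr (ρ i)‖) := by
  have h := (hρ.hasRankOneSum i).summable.hasSum
  have e := (hρ.hasSum_norm_sqrt_sq i).unique (Complex.hasSum_ofReal.2 h)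
  rwa [e, Complex.norm_real, Real.norm_of_nonneg (tsum_nonneg fun k => by positivity)]

/-- Bounds the scalar weights in `𝓔(x ⊗ y)` by `‖y‖`, uniformly in the site. -/
theorem norm_siteState_le (v : siteSupport ρ) (x : WalkAlg ρ) :
    ‖siteState ρ v x‖ ≤ ‖x‖ * ‖tr (ρ v)‖ := by
  rw [← (hρ.hasSum_siteState v x).tsum_eq]
  refine tsum_of_norm_bounded ((hρ.hasSum_norm_sqrt_sq_real v).mul_left ‖x‖) fun k => ?_
  refine (norm_inner_apply_le x _).trans_eq ?_
  rw [siteVector, LinearIsometry.norm_map]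

theorem hasSum_initialState (x : WalkAlg ρ) :
    HasSum (fun v => siteState ρ v x) (initialState ρ x) := by
  have hu : Summable fun p : Σ _ : siteSupport ρ, basisIndex H => ‖siteVector ρ p.1 p.2‖ ^ 2 := by
    rw [summable_sigma_of_nonneg fun p => by positivity]
    simp only [siteVector, LinearIsometry.norm_map]
    refine ⟨fun v => (hρ.hasSum_norm_sqrt_sq_real v).summable, ?_⟩
    simp only [(hρ.hasSum_norm_sqrt_sq_real _).tsum_eq]
    exact hρ.hasSum_tr.summable.norm.subtype _
  have h := HasRankOneSum.of_sigma (T := fun v : siteSupport ρ => blockOp v v (ρ v)) hu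
    hρ.hasRankOneSum_siteVector
  exact (h.hasSum_tr x).sigma (hρ.hasSum_siteState · x)

/-- The series defining the transition expectation converges strongly and unconditionally. -/
theorem hasStrongSum_transitionExpectation (hB : IsWalk B) (x y : WalkAlg ρ) :
    HasStrongSum (transitionTerm B ρ x y) (transitionExpectation B ρ x y) := by
  set X := extendZero (siteSupport ρ) x
  -- Absorbing the weight and `X` into the right column leaves `M^i_j` itself as the left one.
  set W : Λ × siteSupport ρ → WalkSpace ρ →L[ℂ] HilbertSum Λ H := fun p =>
    (siteState ρ p.2 y / tr (ρ p.2)) • (X ∘L stepOp B ρ p.1 p.2)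
  have hle : ∀ z p, ‖W p z‖ ^ 2 ≤ (‖y‖ * ‖X‖) ^ 2 * ‖stepOp B ρ p.1 p.2 z‖ ^ 2 := by
    intro z p
    rw [← mul_pow, mul_assoc]
    refine pow_le_pow_left₀ (norm_nonneg _) ?_ 2
    change ‖(siteState ρ p.2 y / tr (ρ p.2)) • X (stepOp B ρ p.1 p.2 z)‖ ≤ _
    rw [norm_smul]
    refine mul_le_mul ?_ (X.le_opNorm _) (norm_nonneg _) (norm_nonneg _)
    rw [norm_div]
    exact div_le_of_le_mul₀ (norm_nonneg _) (norm_nonneg _) (hρ.norm_siteState_le p.2 y)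
  have hV := hB.hasSum_norm_stepOp_sq (ρ := ρ)
  have hW : ∀ z, Summable fun p => ‖W p z‖ ^ 2 := fun z =>
    .of_nonneg_of_le (fun p => by positivity) (hle z) ((hV z).summable.mul_left _)
  obtain ⟨T, hT⟩ := exists_hasStrongSum_adjoint_comp
    (fun p : Λ × siteSupport ρ => stepOp B ρ p.1 p.2) W 1 ((‖y‖ * ‖X‖) ^ 2)
    (fun z => (hV z).summable) (fun z => by rw [(hV z).tsum_eq, one_mul]) hW
    (fun z => by
      rw [← (hV z).tsum_eq, ← tsum_mul_left]
      exact (hW z).tsum_le_tsum (hle z) ((hV z).summable.mul_left _))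
  refine HasStrongSum.hasStrongSum_strongSum (T := T) fun z => ?_
  convert! hT z using 1
  funext p
  exact (map_smul (ContinuousLinearMap.adjoint (stepOp B ρ p.1 p.2))
    (siteState ρ p.2 y / tr (ρ p.2)) (X (stepOp B ρ p.1 p.2 z))).symm

/-- The operator `B^i_v ρ_v B^{i*}_v ⊗ |i⟩⟨i|` has the images of the site vectors under `M^i_v` as
its rank-one vectors. -/
theorem hasSum_psiTerm_fiber (v : siteSupport ρ) (x : WalkAlg ρ) (i : Λ) :
    HasSum (fun k => ⟪stepOp B ρ i v (siteVector ρ v k),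
      extendZero (siteSupport ρ) x (stepOp B ρ i v (siteVector ρ v k))⟫_ℂ)
      (psiTerm B ρ v x i) := by
  convert! (((hρ.hasRankOneSum v).conj (B i v)).blockOp i).hasSum_tr
    (extendZero (siteSupport ρ) x) using 1
  funext k
  rw [stepOp_apply, siteVector, ketIsometry_apply_self]

/-- Square-summability comes from summing over `i` first, which by the walk condition leaves `∑
‖√ρ_v (e k)‖ ^ 2`. This licenses exchanging `i` and `k`. -/
theorem summable_stepOp_siteVector (hB : IsWalk B) (v : siteSupport ρ) (x : WalkAlg ρ) :
    Summable fun p : Λ × basisIndex H => ⟪stepOp B ρ p.1 v (siteVector ρ v p.2),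
      extendZero (siteSupport ρ) x (stepOp B ρ p.1 v (siteVector ρ v p.2))⟫_ℂ := by
  refine summable_norm_inner_apply ?_ (extendZero (siteSupport ρ) x)
  have h1 : ∀ k : basisIndex H, HasSum (fun i => ‖B i v (CFC.sqrt (ρ v) (stdBasis H k))‖ ^ 2)
      (‖CFC.sqrt (ρ v) (stdBasis H k)‖ ^ 2) := fun k => hB.hasSum_norm_sq v _
  have h : Summable fun p : basisIndex H × Λ =>
      ‖B p.2 v (CFC.sqrt (ρ v) (stdBasis H p.1))‖ ^ 2 := by
    rw [summable_prod_of_nonneg fun p => by positivity]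
    refine ⟨fun k => (h1 k).summable, ?_⟩
    have h2 := (hρ.hasSum_norm_sqrt_sq_real v).summable
    simp_rw [← (h1 _).tsum_eq] at h2
    exact h2
  refine h.prod_symm.congr fun p => ?_
  rw [stepOp_apply, siteVector, ketIsometry_apply_self, LinearIsometry.norm_map]
  rfl

theorem summable_psiTerm (hB : IsWalk B) (v : siteSupport ρ) (x : WalkAlg ρ) :
    Summable (psiTerm B ρ v x) :=
  ((hρ.summable_stepOp_siteVector hB v x).hasSum.prod_fiberwise
    (hρ.hasSum_psiTerm_fiber v x)).summable

theorem hasSum_inner_transitionExpectation (hB : IsWalk B) (v : siteSupport ρ) (x y : WalkAlg ρ)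
    (k : basisIndex H) :
    HasSum (fun i => siteState ρ v y / tr (ρ v) * ⟪stepOp B ρ i v (siteVector ρ v k),
      extendZero (siteSupport ρ) x (stepOp B ρ i v (siteVector ρ v k))⟫_ℂ)
      ⟪siteVector ρ v k, transitionExpectation B ρ x y (siteVector ρ v k)⟫_ℂ := by
  set u := siteVector ρ v k
  have h := (hρ.hasStrongSum_transitionExpectation hB x y u).mapL (innerSL ℂ u)
  have hterm : ∀ p : Λ × siteSupport ρ, innerSL ℂ u (transitionTerm B ρ x y p u) =
      siteState ρ p.2 y / tr (ρ p.2) * ⟪stepOp B ρ p.1 p.2 u,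
        extendZero (siteSupport ρ) x (stepOp B ρ p.1 p.2 u)⟫_ℂ := by
    intro p
    rw [← ContinuousLinearMap.adjoint_inner_right, ← inner_smul_right]
    rfl
  simp only [hterm] at h
  -- Since `u` lives at site `v`, only the pairs `(i, v)` contribute.
  refine (Function.Injective.hasSum_iff (g := fun i : Λ => (i, v))
    (fun i i' e => congrArg Prod.fst e) fun p hp => ?_).2 h
  have hne : p.2 ≠ v := fun e => hp ⟨p.1, Prod.ext rfl e.symm⟩
  have h0 : stepOp B ρ p.1 p.2 u = 0 := by
    rw [stepOp_apply, show u p.2 = 0 from ketIsometry_apply_ne hne _, map_zero, map_zero]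
  rw [h0, inner_zero_left, mul_zero]

/-- `Tr((ρ_v ⊗ |v⟩⟨v|) 𝓔(x ⊗ y)) = ψ_v(x) Tr((ρ_v ⊗ |v⟩⟨v|) y)`. -/
theorem siteState_transitionExpectation (hB : IsWalk B) (v : siteSupport ρ) (x y : WalkAlg ρ) :
    siteState ρ v (transitionExpectation B ρ x y) = psi B ρ v x * siteState ρ v y := by
  -- One double series summed both ways: over `k` first it gives the terms of `ψ_v(x)`, over `i`
  -- first (after weighting) the diagonal entries of `𝓔(x ⊗ y)`. The factor `Tr(ρ_v)⁻¹` appears on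
  -- both sides, so nothing has to be cancelled.
  have hs := hρ.summable_stepOp_siteVector hB v x
  have h1 := hs.hasSum.prod_fiberwise (hρ.hasSum_psiTerm_fiber v x)
  have h2 := (hs.mul_left (siteState ρ v y / tr (ρ v))).prod_symm.hasSum.prod_fiberwise
    (hρ.hasSum_inner_transitionExpectation hB v x y)
  rw [(hρ.hasSum_siteState v _).unique h2, psi, h1.tsum_eq]
  have e := (Equiv.prodComm (basisIndex H) Λ).tsum_eq fun p : Λ × basisIndex H =>
    siteState ρ v y / tr (ρ v) * ⟪stepOp B ρ p.1 v (siteVector ρ v p.2),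
      extendZero (siteSupport ρ) x (stepOp B ρ p.1 v (siteVector ρ v p.2))⟫_ℂ
  refine e.trans ?_
  rw [tsum_mul_left]
  ring

theorem siteState_foldr (hB : IsWalk B) (v : siteSupport ρ) (l : List (WalkAlg ρ)) :
    siteState ρ v (l.foldr (transitionExpectation B ρ) 1) =
      tr (ρ v) * (l.map (psi B ρ v)).prod := by
  induction l with
  | nil => simp [hρ.siteState_one v]
  | cons x l ih =>
    rw [List.foldr_cons, hρ.siteState_transitionExpectation hB, ih, List.map_cons, List.prod_cons]
    ring

theorem hasSum_markovValue (hB : IsWalk B) {n : ℕ} (x : Fin n → WalkAlg ρ) :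
    HasSum (fun v : siteSupport ρ => tr (ρ v) * ∏ k, psi B ρ v (x k))
      (markovValue (initialState ρ) (transitionExpectation B ρ) x) := by
  convert! hρ.hasSum_initialState ((List.ofFn x).foldr (transitionExpectation B ρ) 1) using 1
  funext v
  rw [hρ.siteState_foldr hB, List.map_ofFn, List.prod_ofFn]
  rfl

end IsBlockDensity

end Walk

end OQRW

end

theorem mainTheorem3 {Λ H : Type*} [NormedAddCommGroup H] [InnerProductSpace ℂ H]
    [CompleteSpace H] (B : Λ → Λ → (H →L[ℂ] H)) (hB : OQRW.IsWalk B)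
    (ρ : Λ → (H →L[ℂ] H)) (hρ : OQRW.IsBlockDensity ρ) :
    (∀ x y : OQRW.WalkAlg ρ,
      OQRW.HasStrongSum (OQRW.transitionTerm B ρ x y) (OQRW.transitionExpectation B ρ x y)) ∧
    (∀ (v : OQRW.siteSupport ρ) (x : OQRW.WalkAlg ρ), Summable (OQRW.psiTerm B ρ v x)) ∧
    (∀ (n : ℕ) (x : Fin (n + 1) → OQRW.WalkAlg ρ),
      HasSum (fun v : OQRW.siteSupport ρ =>
          OQRW.tr (ρ v) * ∏ k : Fin (n + 1), OQRW.psi B ρ v (x k))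
        (OQRW.markovValue (OQRW.initialState ρ) (OQRW.transitionExpectation B ρ) x)) ∧
    (∀ φ : OQRW.chainAlgebra (OQRW.WalkSpace ρ) →ₗ[ℂ] ℂ,
      OQRW.IsQuantumMarkovChain (OQRW.initialState ρ) (OQRW.transitionExpectation B ρ) φ →
      ∀ (n : ℕ) (x : Fin (n + 1) → OQRW.WalkAlg ρ),
        HasSum (fun v : OQRW.siteSupport ρ =>
            OQRW.tr (ρ v) * ∏ k : Fin (n + 1), OQRW.psi B ρ v (x k))
          (φ (OQRW.pureTensor x))) := by
  refine ⟨hρ.hasStrongSum_transitionExpectation hB, hρ.summable_psiTerm hB,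
    fun n x => hρ.hasSum_markovValue hB x, fun φ hφ n x => ?_⟩
  rw [hφ.map_pureTensor]
  exact hρ.hasSum_markovValue hB x
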